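/- **Asymptotic scales and Colombeau extensions.** Let $(\Upsilon,\prec)$ be a non-empty directed set and let $\mho=\{\varsigma_\ell\}_{\ell\in\Upsilon}$ be an asymptotic scale: each $\varsigma_\ell:(0,1)\to(0,\infty)$ is continuous and increasing in a neighbourhood of $0$; $\ell\prec\jmath$ implies $\varsigma_\ell=o(\varsigma_\jmath)$ as $\epsilon\to0$; and for all $\ell,\jmath\in\Upsilon$ there is $\hbar\in\Upsilon$ with $\varsigma_\hbar=o(\varsigma_\ell\varsigma_\jmath)$ as $\epsilon\to0$. For a locally convex space $\mathcal X$ with seminorms $\{\|\cdot\|_\alpha\}$, a net $(h_\epsilon)_{\epsilon\in(0,1)}\subset\mathcal X$ is *moderate* if for every $\alpha$ there is $\ell$ with $\varsigma_\ell(\epsilon)\|h_\epsilon\|_\alpha=o(1)$, and *negligible* if $\|h_\epsilon\|_\alpha=o(\varsigma_\ell(\epsilon))$ for all $\alpha$ and all $\ell$. Let $\mathcal G^\mho(\mathcal X)$ be the quotient of the space of moderate nets by that of negligible nets. **Spaces.** Let $n\in\mathbb N$, $1<q<\infty$, $\mathbb R_+=(0,\infty)$, and let $W^{q,\infty}(\mathbb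 R^n)$ be the space of all (real- or complex-valued) $f\in L^q(\mathbb R^n)$ whose weak derivatives of all orders lie in $L^q(\mathbb R^n)$, with the seminorms $\|\partial_x^\alpha f\|_q$. Put $$\mathcal X_q=C^\infty(\mathbb R_+,W^{q,\infty}(\mathbb R^n))\cap C([0,\infty),L^q(\mathbb R^n)),$$ with the seminorms $\sup_{t\in K}\|\partial_t^j\partial_x^\alpha u(t)\|_q$ ($K\subset\mathbb R_+$ compact, $j\in\mathbb N_0$, $\alpha\in\mathbb N_0^n$) and $\sup_{t\in[0,b]}\|u(t)\|_q$ ($b\in\mathbb N$). The space $C^\infty(\mathbb R_+,M_n(\mathbb R))\cap C([0,\infty),M_n(\mathbb R))$ carries the analogous seminorms. **Diffusivity.** Let $a$ be an element of $\mathcal G^\mho\big(C^\infty(\mathbb R_+,M_n(\mathbb R))\cap C([0,\infty),M_n(\mathbb R))\big)$ which is the class of a moderate net $(a_\epsilon)$ such that $a_\epsilon\in C^\infty(\mathbb R_+,\mathrm{GL}(n))\cap C([0,\infty),\mathrm{GL}(n))$ and $a_\epsilon(t)$ is symmetric positive definite for all $t>0$ and all $\epsilon$; such nets are called admissible representatives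 of $a$. **Very weak solutions.** For $u,f\in\mathcal G^\mho(\mathcal X_q)$ we say that $\partial_tu-\mathcal L_tu=f$, where $\mathcal L_t=\langle\partial_x,a\,\partial_x\rangle$, if there are an admissible representative $(a_\epsilon)$ of $a$ and representatives $(u_\epsilon)$ of $u$ and $(f_\epsilon)$ of $f$ such that $$\partial_tu_\epsilon(t)-\sum_{i,j=1}^n a_{\epsilon,ij}(t)\,\partial_{x_i}\partial_{x_j}u_\epsilon(t)=f_\epsilon(t)\qquad\text{for all }t>0,\ \epsilon\in(0,1).$$ In particular, $\partial_tu-\mathcal L_tu=0$ means that, for suitable representatives, the net $(\partial_tu_\epsilon-\mathcal L^\epsilon_tu_\epsilon)$ belongs to, and is negligible in, $\mathcal X_q$. The restriction $u|_0\in\mathcal G^\mho(L^q(\mathbb R^n))$ is the class of $(u_\epsilon(0))$. **Proposition.** For $q\in(1,\infty)$, every $u\in\mathcal G^\mho(\mathcal X_q)$ which solves the Cauchy problem $$\partial_tu-\mathcal L_tu=0,\qquad u|_0=0,$$ is identically null: $u=0$ in $\mathcal G^\mho(\mathcal X_q)$. -/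

import Mathlib

open scoped NNReal ENNReal ContDiff Topology
open MeasureTheory Set Filter Asymptotics

noncomputable section

namespace VeryWeakHeat

/-! ### Asymptotic scales and Colombeau extensions -/

/-- The parameter set `(0,1)` of the regularisation parameter. -/
abbrev Eps : Type := Ioo (0 : ℝ) 1

/-- The filter `ε → 0` on `(0,1)`. -/
def toZero : Filter Eps := comap ((↑) : Eps → ℝ) (𝓝 0)

/-- An asymptotic scale indexed by a directed set `Υ`: a family of positive continuous functions on
`(0,1)`, each increasing in a neighbourhood of `0`, with the two compatibility conditions. The strict
relation of the directed set is `<`. -/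
structure AsymptoticScale (Υ : Type*) [Preorder Υ] [IsDirectedOrder Υ] [Nonempty Υ] where
  toFun : Υ → Eps → ℝ
  continuous_toFun : ∀ l, Continuous (toFun l)
  pos : ∀ l ε, 0 < toFun l ε
  increasing : ∀ l, ∃ δ : ℝ, 0 < δ ∧ MonotoneOn (toFun l) {ε : Eps | (ε : ℝ) < δ}
  isLittleO_of_lt : ∀ l j, l < j → toFun l =o[toZero] toFun j
  exists_isLittleO_mul : ∀ l j, ∃ h, toFun h =o[toZero] fun ε => toFun l ε * toFun j ε

section Colombeau

variable {Υ : Type*} [Preorder Υ] [IsDirectedOrder Υ] [Nonempty Υ]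

theorem AsymptoticScale.isBigO_one (ς : AsymptoticScale Υ) (l : Υ) :
    ς.toFun l =O[toZero] fun _ => (1 : ℝ) := by
  obtain ⟨δ, hδ, hmono⟩ := ς.increasing l
  set e : Eps := ⟨min (δ / 2) (1 / 2), by
    constructor
    · positivity
    · exact lt_of_le_of_lt (min_le_right _ _) (by norm_num)⟩ with he
  have hpos : (0 : ℝ) < e := e.2.1
  have heδ : (e : ℝ) < δ := lt_of_le_of_lt (min_le_left _ _) (by linarith)
  have hev : ∀ᶠ ε : Eps in toZero, (ε : ℝ) < e :=
    tendsto_comap.eventually (gt_mem_nhds hpos)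
  refine IsBigO.of_bound (ς.toFun l e) ?_
  filter_upwards [hev] with ε hε
  rw [Real.norm_of_nonneg (ς.pos l ε).le, norm_one, mul_one]
  exact hmono (show (ε : ℝ) < δ from hε.trans heδ) heδ (le_of_lt hε)

theorem AsymptoticScale.exists_isBigO_both (ς : AsymptoticScale Υ) (l j : Υ) :
    ∃ h, ς.toFun h =O[toZero] ς.toFun l ∧ ς.toFun h =O[toZero] ς.toFun j := by
  obtain ⟨h, hh⟩ := ς.exists_isLittleO_mul l j
  refine ⟨h, hh.isBigO.trans ?_, hh.isBigO.trans ?_⟩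
  · simpa using (isBigO_refl (ς.toFun l) toZero).mul (ς.isBigO_one j)
  · simpa using (ς.isBigO_one l).mul (isBigO_refl (ς.toFun j) toZero)

variable {𝕜 : Type*} [RCLike 𝕜] {E F : Type*} [AddCommGroup E] [Module 𝕜 E]
  [AddCommGroup F] [Module 𝕜 F] {ι κ : Type*}

/-- Moderate nets in the space `E` whose locally convex structure is given by the seminorms `p`. -/
def moderate (ς : AsymptoticScale Υ) (p : SeminormFamily 𝕜 E ι) : Submodule 𝕜 (Eps → E) where
  carrier := {h | ∀ i, ∃ l, (fun ε => ς.toFun l ε * p i (h ε)) =o[toZero] fun _ => (1 : ℝ)}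
  zero_mem' := fun i => ⟨Classical.arbitrary Υ, by
    simpa using isLittleO_zero (E' := ℝ) (fun _ : Eps => (1 : ℝ)) toZero⟩
  add_mem' := by
    intro g h hg hh i
    obtain ⟨l, hl⟩ := hg i
    obtain ⟨j, hj⟩ := hh i
    obtain ⟨k, hkl, hkj⟩ := ς.exists_isBigO_both l j
    have h1 := (hkl.mul (isBigO_refl (fun ε => p i (g ε)) toZero)).trans_isLittleO hl
    have h2 := (hkj.mul (isBigO_refl (fun ε => p i (h ε)) toZero)).trans_isLittleO hj
    refine ⟨k, IsBigO.trans_isLittleO (IsBigO.of_bound 1 ?_) (h1.add h2)⟩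
    refine Eventually.of_forall fun ε => ?_
    have hς := (ς.pos k ε).le
    have hp := map_add_le_add (p i) (g ε) (h ε)
    have a1 := apply_nonneg (p i) (g ε)
    have a2 := apply_nonneg (p i) (h ε)
    have a3 := apply_nonneg (p i) ((g + h) ε)
    rw [one_mul, Real.norm_of_nonneg (by positivity), Real.norm_of_nonneg (by positivity),
      ← mul_add]
    exact mul_le_mul_of_nonneg_left hp hς
  smul_mem' := by
    intro c h hh i
    obtain ⟨l, hl⟩ := hh i
    refine ⟨l, ?_⟩
    have : (fun ε => ς.toFun l ε * p i ((c • h) ε)) =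
        fun ε => ‖c‖ * (ς.toFun l ε * p i (h ε)) := by
      funext ε
      rw [Pi.smul_apply, map_smul_eq_mul]
      ring
    rw [this]
    exact hl.const_mul_left _

/-- Negligible nets in the space `E` with seminorms `p`. -/
def negligible (ς : AsymptoticScale Υ) (p : SeminormFamily 𝕜 E ι) : Submodule 𝕜 (Eps → E) where
  carrier := {h | ∀ i l, (fun ε => p i (h ε)) =o[toZero] ς.toFun l}
  zero_mem' := fun i l => by simp
  add_mem' := by
    intro g h hg hh i l
    refine IsBigO.trans_isLittleO (IsBigO.of_bound 1 ?_) ((hg i l).add (hh i l))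
    refine Eventually.of_forall fun ε => ?_
    have hp := map_add_le_add (p i) (g ε) (h ε)
    have a1 := apply_nonneg (p i) (g ε)
    have a2 := apply_nonneg (p i) (h ε)
    have a3 := apply_nonneg (p i) ((g + h) ε)
    rw [one_mul, Real.norm_of_nonneg a3, Real.norm_of_nonneg (by positivity)]
    exact hp
  smul_mem' := by
    intro c h hh i l
    have : (fun ε => p i ((c • h) ε)) = fun ε => ‖c‖ * p i (h ε) := by
      funext ε
      rw [Pi.smul_apply, map_smul_eq_mul]
    rw [this]
    exact (hh i l).const_mul_left _

/-- The Colombeau extension: moderate nets modulo negligible nets. -/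
abbrev Colombeau (ς : AsymptoticScale Υ) (p : SeminormFamily 𝕜 E ι) : Type _ :=
  moderate ς p ⧸ (negligible ς p).submoduleOf (moderate ς p)

/-- The class of a moderate net. -/
def Colombeau.mk {ς : AsymptoticScale Υ} {p : SeminormFamily 𝕜 E ι} (h : moderate ς p) :
    Colombeau ς p :=
  Submodule.Quotient.mk h

/-- The part of the Colombeau extension consisting of the classes of moderate nets with values in a
subset `Γ`. -/
def Colombeau.ofSubset (ς : AsymptoticScale Υ) (p : SeminormFamily 𝕜 E ι) (Γ : Set E) :
    Set (Colombeau ς p) :=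
  {x | ∃ h : moderate ς p, (∀ ε, h.1 ε ∈ Γ) ∧ Colombeau.mk h = x}

/-- The map induced on Colombeau extensions by a linear map which is continuous in the (special) sense
that each seminorm of the image is bounded by a seminorm of the argument: `T [h_ε] = [T h_ε]`. -/
def Colombeau.map (ς : AsymptoticScale Υ) (p : SeminormFamily 𝕜 E ι) (q : SeminormFamily 𝕜 F κ)
    (T : E →ₗ[𝕜] F) (hT : ∀ k, ∃ i, ∀ x, q k (T x) ≤ p i x) :
    Colombeau ς p →ₗ[𝕜] Colombeau ς q :=
  Submodule.mapQ _ _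
    ((T.compLeft Eps).restrict (p := moderate ς p) (q := moderate ς q) (by
      intro h hh k
      obtain ⟨i, hi⟩ := hT k
      obtain ⟨l, hl⟩ := hh i
      refine ⟨l, IsBigO.trans_isLittleO (IsBigO.of_bound 1 (Eventually.of_forall fun ε => ?_)) hl⟩
      have hς := (ς.pos l ε).le
      have a1 := apply_nonneg (q k) (T (h ε))
      have a2 := apply_nonneg (p i) (h ε)
      rw [one_mul, Real.norm_of_nonneg (mul_nonneg hς a2)]
      exact (Real.norm_of_nonneg (mul_nonneg hς a1)).le.trans
        (mul_le_mul_of_nonneg_left (hi _) hς)))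
    (by
      intro h hh k l
      obtain ⟨i, hi⟩ := hT k
      have hl : (fun ε => p i (h.1 ε)) =o[toZero] ς.toFun l := hh i l
      refine IsBigO.trans_isLittleO (IsBigO.of_bound 1 (Eventually.of_forall fun ε => ?_)) hl
      have a1 := apply_nonneg (q k) (T (h.1 ε))
      have a2 := apply_nonneg (p i) (h.1 ε)
      rw [one_mul, Real.norm_of_nonneg a2]
      exact (Real.norm_of_nonneg a1).le.trans (hi _))

end Colombeau

/-! ### Suprema over compact sets -/

/-- The seminorm `u ↦ sup_{t ∈ K} ‖L u (t)‖`, for a linear map `L` into continuous functions. -/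
def compactSup {𝕜 : Type*} [RCLike 𝕜] {X S F : Type*} [AddCommGroup X] [Module 𝕜 X]
    [TopologicalSpace S] [NormedAddCommGroup F] [NormedSpace 𝕜 F]
    (K : TopologicalSpace.Compacts S) (L : X →ₗ[𝕜] C(S, F)) : Seminorm 𝕜 X :=
  have hb : ∀ u, BddAbove (range fun t : K => ‖L u t‖) := fun u => by
    have := (K.isCompact.image_of_continuousOn (f := fun t => ‖L u t‖)
      (by fun_prop)).bddAbove
    rwa [image_eq_range] at this
  Seminorm.of (fun u => ⨆ t : K, ‖L u t‖)
    (fun u v => by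
      refine Real.iSup_le (fun t => ?_)
        (add_nonneg (Real.iSup_nonneg fun _ => norm_nonneg _)
          (Real.iSup_nonneg fun _ => norm_nonneg _))
      rw [map_add, ContinuousMap.add_apply]
      exact (norm_add_le _ _).trans (add_le_add (le_ciSup (hb u) t) (le_ciSup (hb v) t)))
    (fun c u => by
      simp only [map_smul, ContinuousMap.smul_apply, norm_smul]
      rw [Real.mul_iSup_of_nonneg (norm_nonneg c)])

/-- Time derivative of order `j` on `(0,∞)` of a smooth function, as a continuous function. -/
def timeDeriv {F : Type*} [NormedAddCommGroup F] [NormedSpace ℝ F] (j : ℕ) (w : ℝ → F)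
    (hw : ContDiffOn ℝ ∞ w (Ioi 0)) : C(Ioi (0 : ℝ), F) where
  toFun t := iteratedDerivWithin j w (Ioi 0) t
  continuous_toFun := continuousOn_iff_continuous_domRestrict.1
    (hw.continuousOn_iteratedDerivWithin (by exact_mod_cast le_top) (uniqueDiffOn_Ioi 0))

/-! ### Weak derivatives and the Sobolev space of infinite order -/

/-- `ℝⁿ`. -/
abbrev Rn (n : ℕ) : Type := EuclideanSpace ℝ (Fin n)

/-- `L^q(ℝⁿ)` with values in `𝕜`, which is `ℝ` or `ℂ`. -/
abbrev Lq (𝕜 : Type*) [RCLike 𝕜] (n : ℕ) (q : ℝ≥0∞) : Type _ := Lp 𝕜 q (volume : Measure (Rn n))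

/-- The iterated partial derivative `∂_{i₁} ⋯ ∂_{iₘ} φ`, where `I = [i₁, …, iₘ]` lists the
coordinate directions (every multi-index arises in this way, and the order is irrelevant for smooth
functions). -/
def iterPartial {n : ℕ} : List (Fin n) → (Rn n → ℝ) → Rn n → ℝ
  | [], φ => φ
  | i :: I, φ => fun x => fderiv ℝ (iterPartial I φ) x (EuclideanSpace.single i 1)

theorem contDiff_iterPartial {n : ℕ} (I : List (Fin n)) {φ : Rn n → ℝ} (hφ : ContDiff ℝ ∞ φ) :
    ContDiff ℝ ∞ (iterPartial I φ) := by
  induction I with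
  | nil => exact hφ
  | cons i I ih =>
    exact (ih.fderiv_right (m := ∞) (by simp)).clm_apply contDiff_const

theorem hasCompactSupport_iterPartial {n : ℕ} (I : List (Fin n)) {φ : Rn n → ℝ}
    (hφ : HasCompactSupport φ) : HasCompactSupport (iterPartial I φ) := by
  induction I with
  | nil => exact hφ
  | cons i I ih => exact ih.fderiv_apply ℝ _

section Sobolev

variable {𝕜 : Type*} [RCLike 𝕜] {n : ℕ} {q : ℝ≥0∞}

/-- `g` is the weak derivative `∂_I f`. -/
def IsWeakDeriv (I : List (Fin n)) (f g : Lq 𝕜 n q) : Prop :=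
  ∀ φ : Rn n → ℝ, ContDiff ℝ ∞ φ → HasCompactSupport φ →
    ∫ x, iterPartial I φ x • f x = (-1) ^ I.length * ∫ x, φ x • g x

theorem IsWeakDeriv.smul {I : List (Fin n)} {f g : Lq 𝕜 n q} (c : 𝕜) (h : IsWeakDeriv I f g) :
    IsWeakDeriv I (c • f) (c • g) := by
  intro φ hφ hc
  have e₁ : ∫ x, iterPartial I φ x • (c • f : Lq 𝕜 n q) x =
      ∫ x, c • (iterPartial I φ x • f x) := by
    refine integral_congr_ae ?_
    filter_upwards [Lp.coeFn_smul c f] with x hx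
    rw [hx, Pi.smul_apply, smul_comm]
  have e₂ : ∫ x, φ x • (c • g : Lq 𝕜 n q) x = ∫ x, c • (φ x • g x) := by
    refine integral_congr_ae ?_
    filter_upwards [Lp.coeFn_smul c g] with x hx
    rw [hx, Pi.smul_apply, smul_comm]
  rw [e₁, e₂, integral_smul, integral_smul, h φ hφ hc, smul_eq_mul, smul_eq_mul]
  ring

variable [Fact (1 ≤ q)]

theorem integrable_smul_Lq {φ : Rn n → ℝ} (hφ : Continuous φ) (hc : HasCompactSupport φ)
    (f : Lq 𝕜 n q) : Integrable fun x => φ x • f x :=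
  ((Lp.memLp f).locallyIntegrable Fact.out).integrable_smul_left_of_hasCompactSupport hφ hc

theorem IsWeakDeriv.add {I : List (Fin n)} {f₁ g₁ f₂ g₂ : Lq 𝕜 n q} (h₁ : IsWeakDeriv I f₁ g₁)
    (h₂ : IsWeakDeriv I f₂ g₂) : IsWeakDeriv I (f₁ + f₂) (g₁ + g₂) := by
  intro φ hφ hc
  have hI := (contDiff_iterPartial I hφ).continuous
  have hIc := hasCompactSupport_iterPartial I hc
  have e₁ : ∫ x, iterPartial I φ x • (f₁ + f₂ : Lq 𝕜 n q) x =
      ∫ x, (iterPartial I φ x • f₁ x + iterPartial I φ x • f₂ x) := by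
    refine integral_congr_ae ?_
    filter_upwards [Lp.coeFn_add f₁ f₂] with x hx
    rw [hx, Pi.add_apply, smul_add]
  have e₂ : ∫ x, φ x • (g₁ + g₂ : Lq 𝕜 n q) x = ∫ x, (φ x • g₁ x + φ x • g₂ x) := by
    refine integral_congr_ae ?_
    filter_upwards [Lp.coeFn_add g₁ g₂] with x hx
    rw [hx, Pi.add_apply, smul_add]
  rw [e₁, e₂, integral_add (integrable_smul_Lq hI hIc f₁) (integrable_smul_Lq hI hIc f₂),
    integral_add (integrable_smul_Lq hφ.continuous hc g₁) (integrable_smul_Lq hφ.continuous hc g₂),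
    h₁ φ hφ hc, h₂ φ hφ hc, mul_add]

theorem IsWeakDeriv.unique {I : List (Fin n)} {f g₁ g₂ : Lq 𝕜 n q} (h₁ : IsWeakDeriv I f g₁)
    (h₂ : IsWeakDeriv I f g₂) : g₁ = g₂ := by
  refine Lp.ext ?_
  refine ae_eq_of_integral_contDiff_smul_eq ((Lp.memLp g₁).locallyIntegrable Fact.out)
    ((Lp.memLp g₂).locallyIntegrable Fact.out) fun φ hφ hc => ?_
  have := (h₁ φ hφ hc).symm.trans (h₂ φ hφ hc)
  exact mul_left_cancel₀ (pow_ne_zero _ (by simp)) this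

variable (𝕜 n q) in
/-- The Sobolev space `W^{q,∞}(ℝⁿ)` of functions all of whose weak derivatives (of all orders) are in
`L^q(ℝⁿ)`. -/
def sobolevInfty : Submodule 𝕜 (Lq 𝕜 n q) where
  carrier := {f | ∀ I : List (Fin n), ∃ g, IsWeakDeriv I f g}
  zero_mem' := fun I => ⟨0, by
    intro φ _ _
    have h0 : (((0 : Lq 𝕜 n q) : Rn n → 𝕜)) =ᵐ[volume] 0 := Lp.coeFn_zero 𝕜 q volume
    have e : ∀ ψ : Rn n → ℝ, ∫ x, ψ x • (0 : Lq 𝕜 n q) x = 0 := fun ψ => by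
      refine integral_eq_zero_of_ae ?_
      filter_upwards [h0] with x hx
      rw [hx]
      simp
    rw [e, e, mul_zero]⟩
  add_mem' := by
    intro f g hf hg I
    obtain ⟨f', hf'⟩ := hf I
    obtain ⟨g', hg'⟩ := hg I
    exact ⟨_, hf'.add hg'⟩
  smul_mem' := by
    intro c f hf I
    obtain ⟨f', hf'⟩ := hf I
    exact ⟨_, hf'.smul c⟩

open Classical in
/-- The weak derivative `∂_I f` (equal to `0` by convention if it does not exist in `L^q`). -/
def weakDeriv (I : List (Fin n)) (f : Lq 𝕜 n q) : Lq 𝕜 n q :=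
  if h : ∃ g, IsWeakDeriv I f g then h.choose else 0

theorem IsWeakDeriv.weakDeriv_eq {I : List (Fin n)} {f g : Lq 𝕜 n q} (h : IsWeakDeriv I f g) :
    weakDeriv I f = g := by
  have h' : ∃ g, IsWeakDeriv I f g := ⟨g, h⟩
  rw [weakDeriv, dif_pos h']
  exact h'.choose_spec.unique h

theorem weakDeriv_add (I : List (Fin n)) {f g : Lq 𝕜 n q} (hf : f ∈ sobolevInfty 𝕜 n q)
    (hg : g ∈ sobolevInfty 𝕜 n q) : weakDeriv I (f + g) = weakDeriv I f + weakDeriv I g := by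
  obtain ⟨f', hf'⟩ := hf I
  obtain ⟨g', hg'⟩ := hg I
  rw [hf'.weakDeriv_eq, hg'.weakDeriv_eq, (hf'.add hg').weakDeriv_eq]

theorem weakDeriv_smul (I : List (Fin n)) (c : 𝕜) {f : Lq 𝕜 n q}
    (hf : f ∈ sobolevInfty 𝕜 n q) : weakDeriv I (c • f) = c • weakDeriv I f := by
  obtain ⟨f', hf'⟩ := hf I
  rw [hf'.weakDeriv_eq, (hf'.smul c).weakDeriv_eq]

/-! ### The space `C^∞(ℝ₊, W^{q,∞}(ℝⁿ)) ∩ C([0,∞), L^q(ℝⁿ))` -/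

/-- The function `t ↦ ∂_I u(t)`, of interest for `t > 0` only. -/
def spaceDeriv (I : List (Fin n)) (u : C(ℝ≥0, Lq 𝕜 n q)) : ℝ → Lq 𝕜 n q :=
  fun t => weakDeriv I (u t.toNNReal)

theorem spaceDeriv_add (I : List (Fin n)) {u v : C(ℝ≥0, Lq 𝕜 n q)}
    (hu : ∀ t, 0 < t → u t ∈ sobolevInfty 𝕜 n q) (hv : ∀ t, 0 < t → v t ∈ sobolevInfty 𝕜 n q) :
    EqOn (spaceDeriv I (u + v)) (spaceDeriv I u + spaceDeriv I v) (Ioi 0) := fun _ ht =>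
  weakDeriv_add I (hu _ (Real.toNNReal_pos.2 ht)) (hv _ (Real.toNNReal_pos.2 ht))

theorem spaceDeriv_smul (I : List (Fin n)) (c : 𝕜) {u : C(ℝ≥0, Lq 𝕜 n q)}
    (hu : ∀ t, 0 < t → u t ∈ sobolevInfty 𝕜 n q) :
    EqOn (spaceDeriv I (c • u)) (c • spaceDeriv I u) (Ioi 0) := fun _ ht =>
  weakDeriv_smul I c (hu _ (Real.toNNReal_pos.2 ht))

variable (𝕜 n q) in
/-- The space `C^∞(ℝ₊, W^{q,∞}(ℝⁿ)) ∩ C([0,∞), L^q(ℝⁿ))`. Smoothness with values in the Fréchet space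
`W^{q,∞}(ℝⁿ)`, whose seminorms are `f ↦ ‖∂_I f‖_q`, means that each `t ↦ ∂_I u(t)` is a smooth function
with values in `L^q(ℝⁿ)`. -/
def solSpace : Submodule 𝕜 C(ℝ≥0, Lq 𝕜 n q) where
  carrier := {u | (∀ t, 0 < t → u t ∈ sobolevInfty 𝕜 n q) ∧
    ∀ I : List (Fin n), ContDiffOn ℝ ∞ (spaceDeriv I u) (Ioi 0)}
  zero_mem' := by
    refine ⟨fun t _ => (sobolevInfty 𝕜 n q).zero_mem, fun I => ?_⟩
    exact contDiffOn_const (c := weakDeriv I (0 : Lq 𝕜 n q))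
  add_mem' := by
    intro u v hu hv
    exact ⟨fun t ht => (sobolevInfty 𝕜 n q).add_mem (hu.1 t ht) (hv.1 t ht), fun I =>
      ((hu.2 I).add (hv.2 I)).congr (spaceDeriv_add I hu.1 hv.1)⟩
  smul_mem' := by
    intro c u hu
    exact ⟨fun t ht => (sobolevInfty 𝕜 n q).smul_mem c (hu.1 t ht), fun I =>
      ((hu.2 I).const_smul c).congr (spaceDeriv_smul I c hu.1)⟩

/-- The mixed derivative `u ↦ ∂_t^j ∂_I u` on `(0,∞)`. -/
def mixedDeriv (j : ℕ) (I : List (Fin n)) : solSpace 𝕜 n q →ₗ[𝕜] C(Ioi (0 : ℝ), Lq 𝕜 n q) where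
  toFun u := timeDeriv j (spaceDeriv I u.1) (u.2.2 I)
  map_add' u v := by
    ext1 t
    have hj : ((j : ℕ∞) : WithTop ℕ∞) ≤ (∞ : WithTop ℕ∞) := by exact_mod_cast le_top
    exact (iteratedDerivWithin_congr (spaceDeriv_add I u.2.1 v.2.1) t.2).trans
      (iteratedDerivWithin_add t.2 (uniqueDiffOn_Ioi 0) ((u.2.2 I t t.2).of_le hj)
        ((v.2.2 I t t.2).of_le hj))
  map_smul' c u := by
    ext1 t
    have hj : ((j : ℕ∞) : WithTop ℕ∞) ≤ (∞ : WithTop ℕ∞) := by exact_mod_cast le_top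
    exact (iteratedDerivWithin_congr (spaceDeriv_smul I c u.2.1) t.2).trans
      (iteratedDerivWithin_const_smul t.2 (uniqueDiffOn_Ioi 0) c ((u.2.2 I t t.2).of_le hj))

/-- The interval `[0,b]`, as a compact subset of `[0,∞)`. -/
def upTo (b : ℕ) : TopologicalSpace.Compacts ℝ≥0 := ⟨Icc 0 (b : ℝ≥0), isCompact_Icc⟩

variable (𝕜 n q) in
/-- The seminorms of `C^∞(ℝ₊, W^{q,∞}(ℝⁿ)) ∩ C([0,∞), L^q(ℝⁿ))`:
`sup_{t ∈ K} ‖∂_t^j ∂_I u(t)‖_q` with `K ⊂ (0,∞)` compact, and `sup_{t ∈ [0,b]} ‖u(t)‖_q`. -/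
def solSeminorms : SeminormFamily 𝕜 (solSpace 𝕜 n q)
    ((ℕ × List (Fin n) × TopologicalSpace.Compacts (Ioi (0 : ℝ))) ⊕ ℕ) :=
  Sum.elim (fun s => compactSup s.2.2 (mixedDeriv s.1 s.2.1))
    (fun b => compactSup (upTo b) (solSpace 𝕜 n q).subtype)

variable (𝕜 n q) in
/-- The norm of `L^q(ℝⁿ)`, as a family of seminorms. -/
def LqSeminorms : SeminormFamily 𝕜 (Lq 𝕜 n q) Unit := fun _ => normSeminorm 𝕜 (Lq 𝕜 n q)

variable (𝕜 n q) in
/-- Evaluation at `t = 0`. -/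
def evalZero : solSpace 𝕜 n q →ₗ[𝕜] Lq 𝕜 n q where
  toFun u := u.1 0
  map_add' _ _ := rfl
  map_smul' _ _ := rfl

theorem evalZero_bounded (k : Unit) :
    ∃ i, ∀ u, LqSeminorms 𝕜 n q k (evalZero 𝕜 n q u) ≤ solSeminorms 𝕜 n q i u := by
  refine ⟨Sum.inr 0, fun u => ?_⟩
  have hb : BddAbove (range fun t : upTo 0 => ‖u.1 t‖) := by
    have := ((upTo 0).isCompact.image_of_continuousOn (f := fun t => ‖u.1 t‖)
      (by fun_prop)).bddAbove
    rwa [image_eq_range] at this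
  exact le_ciSup hb ⟨0, ⟨le_refl _, zero_le⟩⟩

end Sobolev

/-! ### Diffusivities -/

/-- The space `C^∞(ℝ₊, M_n(ℝ)) ∩ C([0,∞), M_n(ℝ))`. -/
def coefSpace (n : ℕ) : Submodule ℝ C(ℝ≥0, Fin n → Fin n → ℝ) where
  carrier := {a | ContDiffOn ℝ ∞ (fun t : ℝ => a t.toNNReal) (Ioi 0)}
  zero_mem' := contDiffOn_const
  add_mem' := fun ha hb => ContDiffOn.add ha hb
  smul_mem' := fun c _ ha => ContDiffOn.const_smul c ha

/-- The derivative `a ↦ ∂_t^j a` on `(0,∞)`. -/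
def coefDeriv {n : ℕ} (j : ℕ) : coefSpace n →ₗ[ℝ] C(Ioi (0 : ℝ), Fin n → Fin n → ℝ) where
  toFun a := timeDeriv j (fun t : ℝ => a.1 t.toNNReal) a.2
  map_add' a b := by
    ext1 t
    have hj : ((j : ℕ∞) : WithTop ℕ∞) ≤ (∞ : WithTop ℕ∞) := by exact_mod_cast le_top
    exact iteratedDerivWithin_add t.2 (uniqueDiffOn_Ioi 0) ((a.2 t t.2).of_le hj)
      ((b.2 t t.2).of_le hj)
  map_smul' c a := by
    ext1 t
    have hj : ((j : ℕ∞) : WithTop ℕ∞) ≤ (∞ : WithTop ℕ∞) := by exact_mod_cast le_top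
    exact iteratedDerivWithin_const_smul t.2 (uniqueDiffOn_Ioi 0) c ((a.2 t t.2).of_le hj)

/-- The seminorms of `C^∞(ℝ₊, M_n(ℝ)) ∩ C([0,∞), M_n(ℝ))`. -/
def coefSeminorms (n : ℕ) : SeminormFamily ℝ (coefSpace n)
    ((ℕ × TopologicalSpace.Compacts (Ioi (0 : ℝ))) ⊕ ℕ) :=
  Sum.elim (fun s => compactSup s.2 (coefDeriv s.1))
    (fun b => compactSup (upTo b) (coefSpace n).subtype)

/-- The regular diffusivities: `a ∈ C^∞(ℝ₊, GL(n)) ∩ C([0,∞), GL(n))` with `a(t)` symmetric and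
positive definite for all `t > 0`. -/
def diffusivities (n : ℕ) : Set (coefSpace n) :=
  {a | (∀ t : ℝ≥0, IsUnit (Matrix.of (a.1 t))) ∧ ∀ t : ℝ≥0, 0 < t → (Matrix.of (a.1 t)).PosDef}

/-! ### The very weak Cauchy problem -/

section Cauchy

variable {Υ : Type*} [Preorder Υ] [IsDirectedOrder Υ] [Nonempty Υ]
  {𝕜 : Type*} [RCLike 𝕜] {n : ℕ} {q : ℝ≥0∞} [Fact (1 ≤ q)]

/-- `∂_t u - ∑_{i,j} a_{ij}(t) ∂_i ∂_j u = f` at all times `t > 0`, for regular `a`, `u`, `f`. -/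
def HeatEquation (a : coefSpace n) (u f : solSpace 𝕜 n q) : Prop :=
  ∀ t : ℝ≥0, 0 < t →
    deriv (fun s : ℝ => u.1 s.toNNReal) t - ∑ i, ∑ j, a.1 t i j • weakDeriv [i, j] (u.1 t) = f.1 t

/-- The very weak heat equation `∂_t u - L_t u = f`: for suitable representatives,
`∂_t u_ε - L_t^ε u_ε` equals `f_ε` in `C^∞(ℝ₊, W^{q,∞}) ∩ C([0,∞), L^q)`; the freedom in `f_ε` is that
of adding a net negligible in that space. -/
def VeryWeakHeatEquation {ς : AsymptoticScale Υ} (a : Colombeau ς (coefSeminorms n))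
    (u f : Colombeau ς (solSeminorms 𝕜 n q)) : Prop :=
  ∃ (A : moderate ς (coefSeminorms n)) (U G : moderate ς (solSeminorms 𝕜 n q)),
    (∀ ε, A.1 ε ∈ diffusivities n) ∧
    Colombeau.mk A = a ∧ Colombeau.mk U = u ∧ Colombeau.mk G = f ∧
    ∀ ε, HeatEquation (A.1 ε) (U.1 ε) (G.1 ε)

/-- The restriction `u ↦ u|₀` on Colombeau extensions. -/
def restrictZero (ς : AsymptoticScale Υ) :
    Colombeau ς (solSeminorms 𝕜 n q) →ₗ[𝕜] Colombeau ς (LqSeminorms 𝕜 n q) :=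
  Colombeau.map ς _ _ (evalZero 𝕜 n q) evalZero_bounded

end Cauchy

end VeryWeakHeat

end

noncomputable section

namespace VeryWeakHeat

/-! ### Curves in normed spaces -/

section Curves

variable {F : Type*} [NormedAddCommGroup F] [NormedSpace ℝ F]

/-! Write the equation for representatives as `∂_t u_ε - L_t^ε u_ε = f_ε`, with `f_ε` and `u_ε(0)`
negligible. The proof has two halves.

The first is an a priori estimate whose constants do not depend on the coefficients: `‖u(T)‖ ≤
‖u(0)‖ + T sup ‖f‖` (`norm_le_of_heatEquation`). A positive semidefinite matrix is a sum of `v vᵀ`,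
so `L` is a sum of squares `∂_v²`. Each square is a limit of second differences of translations,
which are isometries of `L^q`, so `L` is dissipative: `‖f‖ ≤ ‖f - c L f‖` for `c ≥ 0`. Dissipativity
controls each backward Euler step, and summing the steps gives the growth bound. Hence `sup_{[0,b]}
‖u_ε‖` is negligible, however badly `a_ε` degenerates or blows up.

The second handles the derivatives without using the equation. Landau's inequality `‖g'‖ ≤ 2 sup ‖g‖
/ h + h sup ‖g''‖`, with `h` a suitable element of the scale, shows that the first derivative of a
net is negligible if the net is negligible and its second derivative is merely moderate
(`AsymptoticScale.isLittleO_of_interpolation`). Induction on the order, in space along translation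
orbits and then in time, reaches every seminorm (`mem_negligible_of_inr`). -/

/-- The slope may be taken at any point `r` of the interval: the left endpoint serves Landau's
inequality and second differences, the right endpoint serves backward Euler. -/
theorem norm_taylor_le {g g' g'' : ℝ → F} {c h M : ℝ} (hh : 0 ≤ h)
    (hg : ∀ s ∈ Icc c (c + h), HasDerivAt g (g' s) s)
    (hg' : ∀ s ∈ Icc c (c + h), HasDerivAt g' (g'' s) s)
    (hM : ∀ s ∈ Icc c (c + h), ‖g'' s‖ ≤ M) {r : ℝ} (hr : r ∈ Icc c (c + h)) :
    ‖g (c + h) - g c - h • g' r‖ ≤ M * h * h := by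
  have hM0 : 0 ≤ M := (norm_nonneg _).trans (hM r hr)
  have h1 : ∀ s ∈ Icc c (c + h), ‖g' s - g' r‖ ≤ M * h := by
    intro s hs
    refine ((convex_Icc c (c + h)).norm_image_sub_le_of_norm_hasDerivWithin_le
      (fun x hx => (hg' x hx).hasDerivWithinAt) hM hr hs).trans
      (mul_le_mul_of_nonneg_left ?_ hM0)
    rw [Real.norm_eq_abs, abs_le]
    constructor <;> linarith [hs.1, hs.2, hr.1, hr.2]
  have h2 := norm_image_sub_le_of_norm_deriv_le_segment' (f := fun s => g s - s • g' r)
    (f' := fun s => g' s - g' r) (a := c) (b := c + h) (C := M * h)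
    (fun s hs => ((hg s hs).sub (by simpa using (hasDerivAt_id s).smul_const (g' r))).hasDerivWithinAt)
    (fun s hs => h1 s (Ico_subset_Icc_self hs)) (c + h) ⟨by linarith, le_rfl⟩
  calc ‖g (c + h) - g c - h • g' r‖
      = ‖(g (c + h) - (c + h) • g' r) - (g c - c • g' r)‖ := by
        congr 1
        rw [add_smul]
        abel
    _ ≤ M * h * (c + h - c) := h2
    _ = M * h * h := by ring

/-- The Landau inequality on an interval of length `h`. -/
theorem norm_deriv_le_landau {g g' g'' : ℝ → F} {c h N M : ℝ} (hh : 0 < h)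
    (hg : ∀ s ∈ Icc c (c + h), HasDerivAt g (g' s) s)
    (hg' : ∀ s ∈ Icc c (c + h), HasDerivAt g' (g'' s) s)
    (hN : ∀ s ∈ Icc c (c + h), ‖g s‖ ≤ N) (hM : ∀ s ∈ Icc c (c + h), ‖g'' s‖ ≤ M) :
    ‖g' c‖ ≤ 2 * N / h + h * M := by
  have hc : c ∈ Icc c (c + h) := ⟨le_rfl, by linarith⟩
  have hch : c + h ∈ Icc c (c + h) := ⟨by linarith, le_rfl⟩
  have h1 := norm_taylor_le hh.le hg hg' hM hc
  have h2 : ‖h • g' c‖ ≤ 2 * N + M * h * h := by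
    calc ‖h • g' c‖ = ‖g (c + h) - g c - (g (c + h) - g c - h • g' c)‖ := by congr 1; abel
      _ ≤ ‖g (c + h)‖ + ‖g c‖ + ‖g (c + h) - g c - h • g' c‖ :=
        (norm_sub_le _ _).trans (add_le_add_left (norm_sub_le _ _) _)
      _ ≤ 2 * N + M * h * h := by linarith [hN _ hc, hN _ hch]
  rw [norm_smul, Real.norm_of_nonneg hh.le] at h2
  have h3 : 2 * N / h + h * M = (2 * N + M * h * h) / h := by field_simp
  rw [h3, le_div_iff₀ hh]
  linarith

/-- A curve whose backward Euler steps do not increase the norm by more than `h * B` grows at rate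
at most `B`. -/
theorem norm_le_of_backward_euler {g g' g'' : ℝ → F} {c d B : ℝ} (hcd : c ≤ d)
    (hg : ∀ s ∈ Icc c d, HasDerivAt g (g' s) s)
    (hg' : ∀ s ∈ Icc c d, HasDerivAt g' (g'' s) s) (hcont : ContinuousOn g'' (Icc c d))
    (hB : ∀ s ∈ Icc c d, ∀ h : ℝ, 0 ≤ h → ‖g s‖ ≤ ‖g s - h • g' s‖ + h * B) :
    ‖g d‖ ≤ ‖g c‖ + (d - c) * B := by
  obtain ⟨M, hM⟩ := isCompact_Icc.exists_bound_of_continuousOn hcont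
  have hstep : ∀ N : ℕ, 0 < N → ‖g d‖ ≤ ‖g c‖ + (d - c) * B + M * (d - c) ^ 2 / N := by
    intro N hN
    have hN' : (0 : ℝ) < N := by exact_mod_cast hN
    set h : ℝ := (d - c) / N with hh
    have h0 : 0 ≤ h := div_nonneg (by linarith) hN'.le
    have hNh : N * h = d - c := by rw [hh]; field_simp
    -- Each step of length `h = (d - c) / N` costs `h * B` plus a consistency error `M * h * h`. The
    -- `N` errors add up to `M * (d - c) ^ 2 / N`, which vanishes in the limit.
    have key : ∀ k : ℕ, k ≤ N → ‖g (c + k * h)‖ ≤ ‖g c‖ + k * (h * B + M * h * h) := by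
      intro k
      induction k with
      | zero => simp
      | succ k ih =>
        intro hk
        have ih' := ih (by omega)
        have hk1 : ((k + 1 : ℕ) : ℝ) * h ≤ d - c := by
          rw [← hNh]
          exact mul_le_mul_of_nonneg_right (by exact_mod_cast hk) h0
        have hk0 : 0 ≤ (k : ℝ) * h := by positivity
        have e : c + ((k + 1 : ℕ) : ℝ) * h = c + k * h + h := by push_cast; ring
        have hsub : Icc (c + k * h) (c + k * h + h) ⊆ Icc c d := by
          refine Icc_subset_Icc (by linarith) ?_
          rw [← e]
          linarith
        have hr : c + k * h + h ∈ Icc (c + k * h) (c + k * h + h) := ⟨by linarith, le_rfl⟩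
        have h1 := norm_taylor_le h0 (fun s hs => hg s (hsub hs)) (fun s hs => hg' s (hsub hs))
          (fun s hs => hM s (hsub hs)) hr
        have h2 := hB _ (hsub hr) h h0
        have h3 : ‖g (c + k * h + h) - h • g' (c + k * h + h)‖ ≤ ‖g (c + k * h)‖ + M * h * h := by
          calc _ = ‖g (c + k * h) + (g (c + k * h + h) - g (c + k * h)
                - h • g' (c + k * h + h))‖ := by congr 1; abel
            _ ≤ _ := (norm_add_le _ _).trans (by linarith)
        rw [e]
        push_cast
        linarith
    have hfin := key N le_rfl
    rw [hNh, add_sub_cancel] at hfin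
    calc ‖g d‖ ≤ _ := hfin
      _ = ‖g c‖ + (N * h) * B + M * (N * h) * h := by ring
      _ = _ := by rw [hNh, hh]; ring
  have hlim : Tendsto (fun N : ℕ => ‖g c‖ + (d - c) * B + M * (d - c) ^ 2 / N) atTop
      (𝓝 (‖g c‖ + (d - c) * B + 0)) :=
    tendsto_const_nhds.add (tendsto_const_div_atTop_nhds_zero_nat _)
  rw [add_zero] at hlim
  exact ge_of_tendsto hlim ((eventually_gt_atTop 0).mono hstep)

end Curves

/-! ### Weak derivatives of weak derivatives -/

section Translation

variable {𝕜 : Type*} [RCLike 𝕜] {n : ℕ} {q : ℝ≥0∞}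

theorem iterPartial_append (I J : List (Fin n)) (φ : Rn n → ℝ) :
    iterPartial (I ++ J) φ = iterPartial I (iterPartial J φ) := by
  induction I with
  | nil => rfl
  | cons i I ih => rw [List.cons_append, iterPartial, iterPartial, ih]

theorem isWeakDeriv_nil (f : Lq 𝕜 n q) : IsWeakDeriv [] f f := fun φ _ _ => by simp [iterPartial]

/-- If `φ` is a test function, so is `∂_J φ`; testing the first relation with it and cancelling the
sign `(-1) ^ I.length` isolates `∂_J g`. -/
theorem IsWeakDeriv.of_append {I J : List (Fin n)} {f g h : Lq 𝕜 n q} (hg : IsWeakDeriv I f g)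
    (hh : IsWeakDeriv (I ++ J) f h) : IsWeakDeriv J g h := by
  intro φ hφ hc
  have h1 := hg _ (contDiff_iterPartial J hφ) (hasCompactSupport_iterPartial J hc)
  have h2 := hh φ hφ hc
  rw [iterPartial_append, h1, List.length_append, pow_add, mul_assoc] at h2
  exact mul_left_cancel₀ (pow_ne_zero _ (by simp)) h2

variable [Fact (1 ≤ q)]

theorem weakDeriv_nil (f : Lq 𝕜 n q) : weakDeriv [] f = f := (isWeakDeriv_nil f).weakDeriv_eq

theorem isWeakDeriv_weakDeriv {f : Lq 𝕜 n q} (hf : f ∈ sobolevInfty 𝕜 n q) (I : List (Fin n)) :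
    IsWeakDeriv I f (weakDeriv I f) := by
  obtain ⟨g, hg⟩ := hf I
  rwa [hg.weakDeriv_eq]

theorem weakDeriv_mem {f : Lq 𝕜 n q} (hf : f ∈ sobolevInfty 𝕜 n q) (I : List (Fin n)) :
    weakDeriv I f ∈ sobolevInfty 𝕜 n q := fun J =>
  ⟨_, (isWeakDeriv_weakDeriv hf I).of_append (isWeakDeriv_weakDeriv hf (I ++ J))⟩

theorem weakDeriv_weakDeriv {f : Lq 𝕜 n q} (hf : f ∈ sobolevInfty 𝕜 n q) (I J : List (Fin n)) :
    weakDeriv J (weakDeriv I f) = weakDeriv (I ++ J) f :=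
  ((isWeakDeriv_weakDeriv hf I).of_append (isWeakDeriv_weakDeriv hf (I ++ J))).weakDeriv_eq

theorem smul_mem_sobolevInfty (c : ℝ) {f : Lq 𝕜 n q} (hf : f ∈ sobolevInfty 𝕜 n q) :
    c • f ∈ sobolevInfty 𝕜 n q := by
  rw [← algebraMap_smul 𝕜 c f]
  exact (sobolevInfty 𝕜 n q).smul_mem _ hf

theorem weakDeriv_real_smul (I : List (Fin n)) (c : ℝ) {f : Lq 𝕜 n q}
    (hf : f ∈ sobolevInfty 𝕜 n q) : weakDeriv I (c • f) = c • weakDeriv I f := by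
  rw [← algebraMap_smul 𝕜 c f, weakDeriv_smul I _ hf, algebraMap_smul]

theorem weakDeriv_zero (I : List (Fin n)) : weakDeriv I (0 : Lq 𝕜 n q) = 0 := by
  simpa using weakDeriv_smul I (0 : 𝕜) (sobolevInfty 𝕜 n q).zero_mem

theorem weakDeriv_sum {ι : Type*} (I : List (Fin n)) (s : Finset ι) {f : ι → Lq 𝕜 n q}
    (hf : ∀ k, f k ∈ sobolevInfty 𝕜 n q) :
    weakDeriv I (∑ k ∈ s, f k) = ∑ k ∈ s, weakDeriv I (f k) := by
  classical
  induction s using Finset.induction_on with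
  | empty => simp [weakDeriv_zero]
  | insert k s hk ih =>
    rw [Finset.sum_insert hk, Finset.sum_insert hk,
      weakDeriv_add I (hf k) (Submodule.sum_mem _ fun k _ => hf k), ih]

/-! ### Directional derivatives and translations -/

/-- The weak derivative in the direction `b`. -/
def dirDeriv (b : Rn n) (f : Lq 𝕜 n q) : Lq 𝕜 n q := ∑ i, b i • weakDeriv [i] f

theorem dirDeriv_mem (b : Rn n) {f : Lq 𝕜 n q} (hf : f ∈ sobolevInfty 𝕜 n q) :
    dirDeriv b f ∈ sobolevInfty 𝕜 n q :=
  Submodule.sum_mem _ fun i _ => smul_mem_sobolevInfty _ (weakDeriv_mem hf [i])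

omit [Fact (1 ≤ q)] in
theorem dirDeriv_single (i : Fin n) (f : Lq 𝕜 n q) :
    dirDeriv (EuclideanSpace.single i 1) f = weakDeriv [i] f := by
  classical
  rw [dirDeriv, Finset.sum_eq_single i]
  · simp
  · intro j _ hj
    simp [hj]
  · simp

theorem dirDeriv_dirDeriv (b : Rn n) {f : Lq 𝕜 n q} (hf : f ∈ sobolevInfty 𝕜 n q) :
    dirDeriv b (dirDeriv b f) = ∑ i, ∑ j, (b i * b j) • weakDeriv [i, j] f := by
  rw [Finset.sum_comm]
  refine Finset.sum_congr rfl fun j _ => ?_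
  rw [dirDeriv, weakDeriv_sum _ _ fun i => smul_mem_sobolevInfty _ (weakDeriv_mem hf [i]),
    Finset.smul_sum]
  refine Finset.sum_congr rfl fun i _ => ?_
  rw [weakDeriv_real_smul _ _ (weakDeriv_mem hf [i]), weakDeriv_weakDeriv hf, smul_smul,
    mul_comm (b j)]
  rfl

theorem integral_smul_dirDeriv (b : Rn n) {f : Lq 𝕜 n q} (hf : f ∈ sobolevInfty 𝕜 n q)
    {φ : Rn n → ℝ} (hφ : ContDiff ℝ ∞ φ) (hc : HasCompactSupport φ) :
    ∫ x, φ x • dirDeriv b f x = -∫ x, fderiv ℝ φ x b • f x := by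
  have e1 : ∀ᵐ x, φ x • dirDeriv b f x = ∑ i, b i • (φ x • weakDeriv [i] f x) := by
    have h1 : ∀ᵐ x, ∀ i, (b i • weakDeriv [i] f : Lq 𝕜 n q) x = b i • weakDeriv [i] f x :=
      ae_all_iff.2 fun i => Lp.coeFn_smul (b i) (weakDeriv [i] f)
    filter_upwards [Lp.coeFn_fun_finsetSum Finset.univ fun i => b i • weakDeriv [i] f, h1] with x hx h1x
    rw [dirDeriv, hx, Finset.smul_sum]
    refine Finset.sum_congr rfl fun i _ => ?_
    rw [h1x, smul_comm]
  have e2 : ∀ x, fderiv ℝ φ x b • f x = ∑ i, b i • (iterPartial [i] φ x • f x) := by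
    intro x
    have hb : b = ∑ i, b i • EuclideanSpace.single i (1 : ℝ) := by
      simpa using ((EuclideanSpace.basisFun (Fin n) ℝ).sum_repr b).symm
    conv_lhs => rw [hb, map_sum, Finset.sum_smul]
    refine Finset.sum_congr rfl fun i _ => ?_
    rw [map_smul, smul_assoc]
    rfl
  have h1 : ∀ i ∈ Finset.univ, Integrable fun x => b i • (φ x • weakDeriv [i] f x) :=
    fun i _ => (integrable_smul_Lq hφ.continuous hc (weakDeriv [i] f)).smul (b i)
  have h2 : ∀ i ∈ Finset.univ, Integrable fun x => b i • (iterPartial [i] φ x • f x) :=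
    fun i _ => (integrable_smul_Lq (contDiff_iterPartial [i] hφ).continuous
      (hasCompactSupport_iterPartial [i] hc) f).smul (b i)
  rw [integral_congr_ae e1, integral_congr_ae (Eventually.of_forall e2),
    integral_finsetSum _ h1, integral_finsetSum _ h2, ← Finset.sum_neg_distrib]
  refine Finset.sum_congr rfl fun i _ => ?_
  rw [integral_smul, integral_smul, isWeakDeriv_weakDeriv hf [i] φ hφ hc]
  simp

/-- Translation of functions, `f ↦ f (· + y)`, as a linear isometry of `L^q`. -/
def translate (y : Rn n) : Lq 𝕜 n q →ₗᵢ[ℝ] Lq 𝕜 n q :=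
  Lp.compMeasurePreservingₗᵢ ℝ (· + y) (measurePreserving_add_right volume y)

theorem coeFn_translate (y : Rn n) (f : Lq 𝕜 n q) :
    translate y f =ᵐ[volume] fun x => f (x + y) :=
  Lp.coeFn_compMeasurePreserving f (measurePreserving_add_right volume y)

/-- Strong continuity of translations is where `q ≠ ⊤` enters; it fails in `L^∞`. -/
theorem continuous_translate (hq : q ≠ ⊤) (f : Lq 𝕜 n q) :
    Continuous fun y : Rn n => translate y f := by
  let g : C(Rn n, C(Rn n, Rn n)) := ContinuousMap.curry ⟨fun p => p.2 + p.1, by fun_prop⟩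
  exact (continuous_const (y := f)).compMeasurePreservingLp g.continuous
    (fun y => measurePreserving_add_right volume y) hq

theorem translate_zero (f : Lq 𝕜 n q) : translate 0 f = f := by
  refine Lp.ext ?_
  filter_upwards [coeFn_translate 0 f] with x hx
  rw [hx, add_zero]

theorem integral_smul_translate (y : Rn n) (f : Lq 𝕜 n q) (φ : Rn n → ℝ) :
    ∫ x, φ x • translate y f x = ∫ x, φ (x - y) • f x := by
  have e : ∫ x, φ x • translate y f x = ∫ x, φ x • f (x + y) := by
    refine integral_congr_ae ?_
    filter_upwards [coeFn_translate y f] with x hx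
    rw [hx]
  rw [e, ← integral_add_right_eq_self (fun x => φ (x - y) • f x) y]
  simp

/-- By Hölder's inequality, since `φ` lies in the conjugate Lebesgue space. Continuity of the
pairing lets it pass through derivatives of `L^q`-valued curves. -/
theorem exists_testPairing {φ : Rn n → ℝ} (hφ : Continuous φ) (hc : HasCompactSupport φ) :
    ∃ Λ : Lq 𝕜 n q →L[ℝ] 𝕜, ∀ f, Λ f = ∫ x, φ x • f x := by
  have hconj : q.HolderConjugate q.conjExponent := ENNReal.HolderConjugate.conjExponent Fact.out
  have := hconj.symm
  have : Fact (1 ≤ q.conjExponent) := ⟨this.one_le⟩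
  have hm : MemLp φ q.conjExponent (volume : Measure (Rn n)) := hφ.memLp_of_hasCompactSupport hc
  refine ⟨(ContinuousLinearMap.lsmul ℝ ℝ : ℝ →L[ℝ] 𝕜 →L[ℝ] 𝕜).lpPairing volume q.conjExponent q
    (hm.toLp φ), fun f => ?_⟩
  rw [ContinuousLinearMap.lpPairing_eq_integral]
  refine integral_congr_ae ?_
  filter_upwards [hm.coeFn_toLp] with x hx
  rw [hx]
  rfl

/-- The pairing is the convolution of `f` with the reflected test function, evaluated at `s • b`.
The derivative therefore falls on the smooth kernel, and integration by parts moves it back to `f`.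
-/
theorem hasDerivAt_integral_translate (b : Rn n) {f : Lq 𝕜 n q} (hf : f ∈ sobolevInfty 𝕜 n q)
    {φ : Rn n → ℝ} (hφ : ContDiff ℝ ∞ φ) (hc : HasCompactSupport φ) (s : ℝ) :
    HasDerivAt (fun s : ℝ => ∫ x, φ x • translate (s • b) f x)
      (∫ x, φ x • translate (s • b) (dirDeriv b f) x) s := by
  set L : 𝕜 →L[ℝ] ℝ →L[ℝ] 𝕜 := (ContinuousLinearMap.lsmul ℝ ℝ).flip with hL
  set ψ : Rn n → ℝ := fun z => φ (-z) with hψ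
  have hψd : ContDiff ℝ ∞ ψ := hφ.comp contDiff_neg
  have hψc : HasCompactSupport ψ := hc.comp_homeomorph (Homeomorph.neg _)
  have hloc : LocallyIntegrable (f : Rn n → 𝕜) := (Lp.memLp f).locallyIntegrable Fact.out
  have h1 := hψc.hasFDerivAt_convolution_right L hloc (hψd.of_le (by simp)) (s • b)
  have h2 : HasDerivAt (fun s : ℝ => s • b) b s := by simpa using (hasDerivAt_id s).smul_const b
  have h3 := h1.comp_hasDerivAt s h2
  rw [convolution_precompR_apply L hloc (hψc.fderiv ℝ)
    (hψd.continuous_fderiv (by simp)) (s • b) b] at h3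
  have e1 : (fun s : ℝ => ∫ x, φ x • translate (s • b) f x) =
      (convolution (f : Rn n → 𝕜) ψ L volume) ∘ fun s : ℝ => s • b := by
    funext s
    rw [integral_smul_translate]
    simp [convolution, hL, hψ]
  have e2 : ∫ x, φ x • translate (s • b) (dirDeriv b f) x =
      convolution (f : Rn n → 𝕜) (fun a => fderiv ℝ ψ a b) L volume (s • b) := by
    have hφs : ContDiff ℝ ∞ fun x => φ (x - s • b) := hφ.comp (contDiff_id.sub contDiff_const)
    have hcs : HasCompactSupport fun x => φ (x - s • b) :=
      hc.comp_homeomorph (Homeomorph.subRight (s • b))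
    rw [integral_smul_translate, integral_smul_dirDeriv b hf hφs hcs, ← integral_neg]
    refine integral_congr_ae (Eventually.of_forall fun x => ?_)
    have d1 : fderiv ℝ (fun x => φ (x - s • b)) x = fderiv ℝ φ (x - s • b) := fderiv_comp_sub _
    have d2 : fderiv ℝ ψ (s • b - x) = -fderiv ℝ φ (x - s • b) := by
      have h := (hφ.differentiable (by simp)).differentiableAt (x := -(s • b - x))
        |>.hasFDerivAt.comp (s • b - x) (hasFDerivAt_id (𝕜 := ℝ) (s • b - x)).neg
      rw [neg_sub] at h
      rw [show ψ = φ ∘ fun z => -z from rfl]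
      refine h.fderiv.trans ?_
      ext
      simp
    simp [d1, d2, hL]
  rw [e1, e2]
  exact h3

/-- Weak differentiability becomes norm differentiability of the orbit: the orbit equals `f` plus
the integral of a continuous curve, because both sides agree at `s = 0` and have the same derivative
against every test function. -/
theorem hasDerivAt_translate (hq : q ≠ ⊤) (b : Rn n) {f : Lq 𝕜 n q}
    (hf : f ∈ sobolevInfty 𝕜 n q) (s : ℝ) :
    HasDerivAt (fun s : ℝ => translate (s • b) f) (translate (s • b) (dirDeriv b f)) s := by
  have hcont : Continuous fun s : ℝ => translate (s • b) (dirDeriv b f) :=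
    (continuous_translate hq _).comp (by fun_prop)
  have hder : ∀ s, HasDerivAt (fun s : ℝ => ∫ r in (0 : ℝ)..s, translate (r • b) (dirDeriv b f))
      (translate (s • b) (dirDeriv b f)) s := fun s =>
    intervalIntegral.integral_hasDerivAt_right (hcont.intervalIntegrable _ _)
      (hcont.stronglyMeasurableAtFilter _ _) hcont.continuousAt
  have key : ∀ s : ℝ, translate (s • b) f =
      f + ∫ r in (0 : ℝ)..s, translate (r • b) (dirDeriv b f) := by
    intro s
    refine Lp.ext (ae_eq_of_integral_contDiff_smul_eq ((Lp.memLp _).locallyIntegrable Fact.out)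
      ((Lp.memLp _).locallyIntegrable Fact.out) fun φ hφ hc => ?_)
    obtain ⟨Λ, hΛ⟩ := exists_testPairing (𝕜 := 𝕜) (q := q) hφ.continuous hc
    rw [← hΛ, ← hΛ, map_add, ← sub_eq_iff_eq_add]
    have hd : ∀ s, HasDerivAt (fun s : ℝ => Λ (translate (s • b) f) -
        Λ (∫ r in (0 : ℝ)..s, translate (r • b) (dirDeriv b f))) 0 s := by
      intro s
      have h1 := hasDerivAt_integral_translate b hf hφ hc s
      simp only [← hΛ] at h1
      have h2 := h1.sub (Λ.hasFDerivAt.comp_hasDerivAt s (hder s))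
      rw [sub_self] at h2
      exact h2
    have := is_const_of_deriv_eq_zero (fun s => (hd s).differentiableAt) (fun s => (hd s).deriv) s 0
    simpa [translate_zero] using this
  rw [show (fun s : ℝ => translate (s • b) f) = fun s =>
    f + ∫ r in (0 : ℝ)..s, translate (r • b) (dirDeriv b f) from funext key]
  exact (hder s).const_add f

/-! ### Interpolation and dissipativity -/

/-- Landau's inequality for the orbit of `∂_I f` under translations along the `i`-th axis; all norms
are constant along the orbit because translations are isometries. -/
theorem norm_weakDeriv_append_le (hq : q ≠ ⊤) {f : Lq 𝕜 n q} (hf : f ∈ sobolevInfty 𝕜 n q)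
    (I : List (Fin n)) (i : Fin n) {h : ℝ} (hh : 0 < h) :
    ‖weakDeriv (I ++ [i]) f‖ ≤
      2 * ‖weakDeriv I f‖ / h + h * ‖weakDeriv (I ++ [i] ++ [i]) f‖ := by
  set b : Rn n := EuclideanSpace.single i 1
  have h1 := weakDeriv_mem hf I
  have h2 := weakDeriv_mem hf (I ++ [i])
  have := norm_deriv_le_landau (c := 0) hh
    (fun s _ => hasDerivAt_translate hq b h1 s)
    (fun s _ => hasDerivAt_translate hq b (dirDeriv_mem b h1) s)
    (fun s _ => ((translate (s • b)).norm_map _).le)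
    (fun s _ => ((translate (s • b)).norm_map _).le)
  rwa [LinearIsometry.norm_map, dirDeriv_single, weakDeriv_weakDeriv hf, dirDeriv_single,
    weakDeriv_weakDeriv hf] at this

/-- The error is of third order in `h`, so it disappears after division by `h * h`. -/
theorem norm_second_difference_le (hq : q ≠ ⊤) (b : Rn n) {f : Lq 𝕜 n q}
    (hf : f ∈ sobolevInfty 𝕜 n q) {h : ℝ} (hh : 0 ≤ h) :
    ‖translate (h • b) f + translate ((-h) • b) f - (2 : ℝ) • f
      - (h * h) • dirDeriv b (dirDeriv b f)‖ ≤
      2 * ‖dirDeriv b (dirDeriv b (dirDeriv b f))‖ * h * h * h := by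
  have hf1 := dirDeriv_mem b hf
  have hf2 := dirDeriv_mem b hf1
  set f1 := dirDeriv b f
  set f2 := dirDeriv b f1
  set M := ‖dirDeriv b f2‖
  have hlip : ∀ s : ℝ, ‖translate (s • b) f2 - f2‖ ≤ M * |s| := by
    intro s
    have := (convex_univ (𝕜 := ℝ)).norm_image_sub_le_of_norm_hasDerivWithin_le (C := M)
      (fun x _ => (hasDerivAt_translate hq b hf2 x).hasDerivWithinAt)
      (fun x _ => ((translate (x • b)).norm_map _).le) (mem_univ 0) (mem_univ s)
    simpa [translate_zero] using this
  have hneg : ∀ {v : Lq 𝕜 n q}, v ∈ sobolevInfty 𝕜 n q → ∀ s : ℝ,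
      HasDerivAt (fun s : ℝ => translate ((-s) • b) v) (-translate ((-s) • b) (dirDeriv b v)) s := by
    intro v hv s
    have := (hasDerivAt_translate hq b hv (-s)).scomp s (hasDerivAt_neg s)
    rw [neg_one_smul] at this
    exact this
  -- The slope is taken at `0`, where `g'` vanishes by symmetry; the Lipschitz bound on the orbit of
  -- `f2` gives `‖g''‖ ≤ 2 * M * h` on `[0, h]`.
  have key := norm_taylor_le (c := 0) (M := 2 * M * h) (r := 0)
    (g := fun s => translate (s • b) f + translate ((-s) • b) f - (s * s) • f2)
    (g' := fun s => translate (s • b) f1 + -translate ((-s) • b) f1 - (2 * s) • f2)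
    (g'' := fun s => translate (s • b) f2 + - -translate ((-s) • b) f2 - (2 : ℝ) • f2) hh
    (fun s _ => by
      refine ((hasDerivAt_translate hq b hf s).add (hneg hf s)).sub ?_
      have h2 : HasDerivAt (fun s : ℝ => s * s) (2 * s) s := by
        have := (hasDerivAt_id s).mul (hasDerivAt_id s)
        rw [one_mul, mul_one, ← two_mul] at this
        exact this
      exact h2.smul_const f2)
    (fun s _ => by
      refine ((hasDerivAt_translate hq b hf1 s).add (hneg hf1 s).neg).sub ?_
      exact (hasDerivAt_const_mul (2 : ℝ)).smul_const f2)
    (fun s hs => by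
      have h0 : 0 ≤ M := norm_nonneg _
      have e1 := hlip s
      have e2 := hlip (-s)
      rw [abs_neg] at e2
      rw [zero_add] at hs
      rw [abs_of_nonneg hs.1] at e1 e2
      calc ‖translate (s • b) f2 + - -translate ((-s) • b) f2 - (2 : ℝ) • f2‖
          = ‖(translate (s • b) f2 - f2) + (translate ((-s) • b) f2 - f2)‖ := by
            congr 1
            rw [two_smul, neg_neg]
            abel
        _ ≤ M * s + M * s := (norm_add_le _ _).trans (add_le_add e1 e2)
        _ ≤ 2 * M * h := by nlinarith [hs.2])
    ⟨le_rfl, by linarith⟩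
  refine le_trans (le_of_eq ?_) key
  congr 1
  simp only [zero_add, zero_smul, neg_zero, translate_zero, mul_zero, sub_zero, add_neg_cancel,
    smul_zero, two_smul]
  abel

/-- The operators `∑ₖ ∂²_{bₖ}` are dissipative in `L^q`. -/
theorem norm_le_norm_sub_sum_dirDeriv (hq : q ≠ ⊤) {ι : Type*} [Fintype ι] (b : ι → Rn n)
    {f : Lq 𝕜 n q} (hf : f ∈ sobolevInfty 𝕜 n q) {c : ℝ} (hc : 0 ≤ c) :
    ‖f‖ ≤ ‖f - c • ∑ k, dirDeriv (b k) (dirDeriv (b k) f)‖ := by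
  set M : ι → ℝ := fun k => 2 * ‖dirDeriv (b k) (dirDeriv (b k) (dirDeriv (b k) f))‖ with hM
  set D : Lq 𝕜 n q := ∑ k, dirDeriv (b k) (dirDeriv (b k) f) with hD
  have key : ∀ h : ℝ, 0 < h → ‖f‖ ≤ ‖f - c • D‖ + c * (∑ k, M k) * h := by
    intro h hh
    set T : ι → Lq 𝕜 n q := fun k => translate (h • b k) f + translate ((-h) • b k) f with hT
    have hTn : ‖∑ k, T k‖ ≤ Fintype.card ι * (2 * ‖f‖) := by
      have h2 : ∀ k ∈ Finset.univ, ‖T k‖ ≤ 2 * ‖f‖ := fun k _ => by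
        refine (norm_add_le _ _).trans_eq ?_
        rw [LinearIsometry.norm_map, LinearIsometry.norm_map, two_mul]
      exact (norm_sum_le_of_le _ h2).trans_eq (by simp)
    have herr : ‖∑ k, (T k - (2 : ℝ) • f) - (h * h) • D‖ ≤ (∑ k, M k) * h * h * h := by
      rw [hD, Finset.smul_sum, ← Finset.sum_sub_distrib, Finset.sum_mul, Finset.sum_mul,
        Finset.sum_mul]
      exact norm_sum_le_of_le _ fun k _ => norm_second_difference_le hq (b k) hf hh.le
    set m : ℝ := (Fintype.card ι : ℝ) with hm
    have hm0 : 0 ≤ m := Nat.cast_nonneg _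
    -- Here `h² D` is traded for second differences. The translates carry total norm at most `2 * m
    -- * ‖f‖`, so after taking norms the terms `2 * c * m * ‖f‖` cancel on both sides and dividing
    -- by `h * h` leaves an error of order `h`.
    have e : (h * h + c * (m * 2)) • f = (h * h) • (f - c • D)
        - c • (∑ k, (T k - (2 : ℝ) • f) - (h * h) • D) + c • ∑ k, T k := by
      rw [Finset.sum_sub_distrib, Finset.sum_const, Finset.card_univ, ← Nat.cast_smul_eq_nsmul ℝ,
        ← hm]
      module
    have h1 : (h * h + c * (m * 2)) * ‖f‖ ≤ (h * h) * ‖f - c • D‖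
        + c * ((∑ k, M k) * h * h * h) + c * (m * (2 * ‖f‖)) := by
      calc (h * h + c * (m * 2)) * ‖f‖ = ‖(h * h + c * (m * 2)) • f‖ := by
            rw [norm_smul, Real.norm_of_nonneg (by positivity)]
        _ ≤ ‖(h * h) • (f - c • D)‖ + ‖c • (∑ k, (T k - (2 : ℝ) • f) - (h * h) • D)‖
            + ‖c • ∑ k, T k‖ := by
            rw [e]
            exact (norm_add_le _ _).trans (by gcongr; exact norm_sub_le _ _)
        _ ≤ _ := by
            rw [norm_smul, norm_smul, norm_smul, Real.norm_of_nonneg (by positivity : 0 ≤ h * h),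
              Real.norm_of_nonneg hc]
            gcongr
    refine le_of_mul_le_mul_left (a := h * h) ?_ (by positivity)
    linarith
  have hlim : Tendsto (fun h : ℝ => ‖f - c • D‖ + c * (∑ k, M k) * h) (𝓝[>] 0)
      (𝓝 (‖f - c • D‖ + c * (∑ k, M k) * 0)) :=
    (Continuous.tendsto (by fun_prop) 0).mono_left nhdsWithin_le_nhds
  rw [mul_zero, add_zero] at hlim
  exact ge_of_tendsto hlim (eventually_nhdsWithin_of_forall key)

/-- With `a = ∑ vₖ vₖᵀ`, the operator `∑ a_{ij} ∂_i ∂_j` is `∑ ∂²_{vₖ}`. No ellipticity constant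
enters. -/
theorem norm_le_norm_sub_posSemidef (hq : q ≠ ⊤) {a : Matrix (Fin n) (Fin n) ℝ}
    (ha : a.PosSemidef) {f : Lq 𝕜 n q} (hf : f ∈ sobolevInfty 𝕜 n q) {c : ℝ} (hc : 0 ≤ c) :
    ‖f‖ ≤ ‖f - c • ∑ i, ∑ j, a i j • weakDeriv [i, j] f‖ := by
  obtain ⟨m, v, rfl⟩ := Matrix.posSemidef_iff_eq_sum_vecMulVec.1 ha
  have := norm_le_norm_sub_sum_dirDeriv hq (fun k => WithLp.toLp 2 (v k)) hf hc
  convert this using 4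
  simp_rw [dirDeriv_dirDeriv _ hf, Matrix.sum_apply, Finset.sum_smul]
  exact (Finset.sum_congr rfl fun i _ => Finset.sum_comm).trans Finset.sum_comm

end Translation

/-! ### Suprema over compact sets -/

section CompactSup

variable {𝕜 : Type*} [RCLike 𝕜] {X S F : Type*} [AddCommGroup X] [Module 𝕜 X]
  [TopologicalSpace S] [NormedAddCommGroup F] [NormedSpace 𝕜 F]

theorem norm_le_compactSup (K : TopologicalSpace.Compacts S) (L : X →ₗ[𝕜] C(S, F)) (u : X) {t : S}
    (ht : t ∈ K) : ‖L u t‖ ≤ compactSup K L u := by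
  have hb : BddAbove (range fun t : K => ‖L u t‖) := by
    have := (K.isCompact.image_of_continuousOn (f := fun t => ‖L u t‖) (by fun_prop)).bddAbove
    rwa [image_eq_range] at this
  exact le_ciSup hb ⟨t, ht⟩

theorem compactSup_le (K : TopologicalSpace.Compacts S) (L : X →ₗ[𝕜] C(S, F)) (u : X) {B : ℝ}
    (hB : 0 ≤ B) (h : ∀ t ∈ K, ‖L u t‖ ≤ B) : compactSup K L u ≤ B :=
  Real.iSup_le (fun t => h t t.2) hB

end CompactSup

/-- The compact set `K + [0,1]`. -/
def unitEnlargement (K : TopologicalSpace.Compacts (Ioi (0 : ℝ))) :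
    TopologicalSpace.Compacts (Ioi (0 : ℝ)) where
  carrier := (fun p : Ioi (0 : ℝ) × unitInterval =>
    (⟨p.1 + p.2, add_pos_of_pos_of_nonneg p.1.2 p.2.2.1⟩ : Ioi (0 : ℝ))) '' (K ×ˢ univ)
  isCompact' := (K.isCompact.prod isCompact_univ).image (by fun_prop)

theorem mem_unitEnlargement {K : TopologicalSpace.Compacts (Ioi (0 : ℝ))} {t s : Ioi (0 : ℝ)}
    (ht : t ∈ K) (h1 : (t : ℝ) ≤ s) (h2 : (s : ℝ) ≤ t + 1) : s ∈ unitEnlargement K :=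
  ⟨(t, ⟨s - t, by linarith, by linarith⟩), ⟨ht, mem_univ _⟩, Subtype.ext (by simp)⟩

theorem hasDerivAt_iteratedDerivWithin_Ioi {F : Type*} [NormedAddCommGroup F] [NormedSpace ℝ F]
    {w : ℝ → F} (hw : ContDiffOn ℝ ∞ w (Ioi 0)) (j : ℕ) {t : ℝ} (ht : 0 < t) :
    HasDerivAt (iteratedDerivWithin j w (Ioi 0)) (iteratedDerivWithin (j + 1) w (Ioi 0) t) t := by
  rw [iteratedDerivWithin_succ]
  exact ((hw.differentiableOn_iteratedDerivWithin (by exact_mod_cast ENat.natCast_lt_top j)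
    (uniqueDiffOn_Ioi 0)) t ht).hasDerivWithinAt.hasDerivAt (Ioi_mem_nhds ht)

/-! ### The estimate for regular solutions -/

section Estimates

variable {𝕜 : Type*} [RCLike 𝕜] {n : ℕ} {q : ℝ≥0∞} [Fact (1 ≤ q)]

theorem norm_le_of_heatEquation (hq : q ≠ ⊤) {a : coefSpace n} (ha : a ∈ diffusivities n)
    {u f : solSpace 𝕜 n q} (h : HeatEquation a u f) {T : ℝ≥0} {B : ℝ}
    (hB : ∀ s ≤ T, ‖f.1 s‖ ≤ B) : ‖u.1 T‖ ≤ ‖u.1 0‖ + T * B := by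
  rcases eq_zero_or_pos T with rfl | hT
  · simp
  set g : ℝ → Lq 𝕜 n q := fun s => u.1 s.toNNReal with hg
  have hsmooth : ContDiffOn ℝ ∞ g (Ioi 0) :=
    (u.2.2 []).congr fun t _ => (weakDeriv_nil _).symm
  -- The solution is only continuous at `0`, so the estimate is run on `[c, T]` with `c > 0`, and `c
  -- → 0` afterwards.
  have key : ∀ c ∈ Ioc (0 : ℝ) T, ‖g T‖ ≤ ‖g c‖ + (T - c) * B := by
    intro c hc
    have hpos : ∀ s ∈ Icc c (T : ℝ), 0 < s := fun s hs => hc.1.trans_le hs.1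
    have hd0 := fun (s : ℝ) (hs : 0 < s) => hasDerivAt_iteratedDerivWithin_Ioi hsmooth 0 hs
    rw [iteratedDerivWithin_zero] at hd0
    refine norm_le_of_backward_euler hc.2 (fun s hs => hd0 s (hpos s hs))
      (fun s hs => hasDerivAt_iteratedDerivWithin_Ioi hsmooth 1 (hpos s hs))
      (fun s hs => (hasDerivAt_iteratedDerivWithin_Ioi hsmooth 2 (hpos s
        hs)).continuousAt.continuousWithinAt) fun s hs k hk => ?_
    have hs0 := hpos s hs
    have hs' : 0 < s.toNNReal := Real.toNNReal_pos.2 hs0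
    have heq := h s.toNNReal hs'
    rw [Real.coe_toNNReal s hs0.le, (hd0 s hs0).deriv, sub_eq_iff_eq_add] at heq
    have hdis := norm_le_norm_sub_posSemidef hq (ha.2 _ hs').posSemidef (u.2.1 _ hs') hk
    refine hdis.trans ?_
    -- By the equation, `u - k L u = (u - k u') + k f`, which turns dissipativity into the backward
    -- Euler hypothesis with `B` bounding the source.
    calc _ = ‖(g s - k • iteratedDerivWithin (0 + 1) g (Ioi 0) s) + k • f.1 s.toNNReal‖ := by
          rw [heq, smul_add]
          congr 1
          simp only [hg, Matrix.of_apply]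
          abel
      _ ≤ _ := by
          refine (norm_add_le _ _).trans (add_le_add le_rfl ?_)
          rw [norm_smul, Real.norm_of_nonneg hk]
          exact mul_le_mul_of_nonneg_left (hB _ (Real.toNNReal_le_iff_le_coe.2 hs.2)) hk
  have hcont : Continuous fun c : ℝ => ‖g c‖ + (T - c) * B :=
    ((u.1.continuous.comp continuous_real_toNNReal).norm).add (by fun_prop)
  have hlim : Tendsto (fun c : ℝ => ‖g c‖ + (T - c) * B) (𝓝[>] 0) (𝓝 (‖g 0‖ + (T - 0) * B)) :=
    (hcont.tendsto 0).mono_left nhdsWithin_le_nhds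
  have := ge_of_tendsto hlim (by
    filter_upwards [Ioc_mem_nhdsGT (show (0 : ℝ) < T from hT)] with c hc using key c hc)
  simpa [hg] using this

theorem solSeminorms_inr_le (hq : q ≠ ⊤) {a : coefSpace n} (ha : a ∈ diffusivities n)
    {u f : solSpace 𝕜 n q} (h : HeatEquation a u f) (b : ℕ) :
    solSeminorms 𝕜 n q (Sum.inr b) u ≤
      LqSeminorms 𝕜 n q () (evalZero 𝕜 n q u) + b * solSeminorms 𝕜 n q (Sum.inr b) f := by
  have hf0 : 0 ≤ solSeminorms 𝕜 n q (Sum.inr b) f := apply_nonneg _ _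
  have hu0 : 0 ≤ LqSeminorms 𝕜 n q () (evalZero 𝕜 n q u) := apply_nonneg _ _
  refine compactSup_le (upTo b) (solSpace 𝕜 n q).subtype u (by positivity) fun t ht => ?_
  refine (norm_le_of_heatEquation hq ha h (B := solSeminorms 𝕜 n q (Sum.inr b) f)
    fun s hs => ?_).trans (add_le_add le_rfl (mul_le_mul_of_nonneg_right ?_ hf0))
  · exact norm_le_compactSup (upTo b) (solSpace 𝕜 n q).subtype f ⟨zero_le, hs.trans ht.2⟩
  · exact_mod_cast ht.2

theorem mixedDeriv_apply (j : ℕ) (I : List (Fin n)) (u : solSpace 𝕜 n q) (t : Ioi (0 : ℝ)) :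
    mixedDeriv j I u t = iteratedDerivWithin j (spaceDeriv I u.1) (Ioi 0) (t : ℝ) := rfl

theorem mixedDeriv_zero_apply (I : List (Fin n)) (u : solSpace 𝕜 n q) (t : Ioi (0 : ℝ)) :
    mixedDeriv 0 I u t = weakDeriv I (u.1 (t : ℝ).toNNReal) :=
  (mixedDeriv_apply 0 I u t).trans (congrFun iteratedDerivWithin_zero (t : ℝ))

theorem solSeminorms_inl_apply (j : ℕ) (I : List (Fin n))
    (K : TopologicalSpace.Compacts (Ioi (0 : ℝ))) (u : solSpace 𝕜 n q) :
    solSeminorms 𝕜 n q (Sum.inl (j, I, K)) u =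
      compactSup K (mixedDeriv (𝕜 := 𝕜) (n := n) (q := q) j I) u := by
  rw [solSeminorms, Sum.elim_inl]

theorem norm_mixedDeriv_le (j : ℕ) (I : List (Fin n)) (K : TopologicalSpace.Compacts (Ioi (0 : ℝ)))
    (u : solSpace 𝕜 n q) {t : Ioi (0 : ℝ)} (ht : t ∈ K) :
    ‖mixedDeriv j I u t‖ ≤ solSeminorms 𝕜 n q (Sum.inl (j, I, K)) u := by
  rw [solSeminorms_inl_apply]
  exact norm_le_compactSup K _ u ht

theorem solSeminorms_inl_le (j : ℕ) (I : List (Fin n)) (K : TopologicalSpace.Compacts (Ioi (0 : ℝ)))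
    (u : solSpace 𝕜 n q) {B : ℝ} (hB : 0 ≤ B) (h : ∀ t ∈ K, ‖mixedDeriv j I u t‖ ≤ B) :
    solSeminorms 𝕜 n q (Sum.inl (j, I, K)) u ≤ B := by
  rw [solSeminorms_inl_apply]
  exact compactSup_le K _ u hB h

theorem exists_solSeminorms_le_inr (K : TopologicalSpace.Compacts (Ioi (0 : ℝ))) :
    ∃ b, ∀ u, solSeminorms 𝕜 n q (Sum.inl (0, [], K)) u ≤ solSeminorms 𝕜 n q (Sum.inr b) u := by
  obtain ⟨C, hC⟩ := (K.isCompact.image continuous_subtype_val).bddAbove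
  obtain ⟨b, hb⟩ := exists_nat_ge C
  refine ⟨b, fun u => solSeminorms_inl_le 0 [] K u (apply_nonneg _ _) fun t ht => ?_⟩
  rw [mixedDeriv_zero_apply, weakDeriv_nil]
  refine norm_le_compactSup (upTo b) (solSpace 𝕜 n q).subtype u ⟨zero_le, ?_⟩
  rw [Real.toNNReal_le_iff_le_coe]
  exact (hC ⟨t, ht, rfl⟩).trans (by exact_mod_cast hb)

theorem solSeminorms_space_interpolation (hq : q ≠ ⊤) (I : List (Fin n)) (i : Fin n)
    (K : TopologicalSpace.Compacts (Ioi (0 : ℝ))) (u : solSpace 𝕜 n q) {h : ℝ} (hh : 0 < h) :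
    solSeminorms 𝕜 n q (Sum.inl (0, I ++ [i], K)) u ≤
      2 * solSeminorms 𝕜 n q (Sum.inl (0, I, K)) u / h
        + h * solSeminorms 𝕜 n q (Sum.inl (0, I ++ [i] ++ [i], K)) u := by
  have h0 : 0 ≤ solSeminorms 𝕜 n q (Sum.inl (0, I, K)) u := apply_nonneg _ _
  have h2 : 0 ≤ solSeminorms 𝕜 n q (Sum.inl (0, I ++ [i] ++ [i], K)) u := apply_nonneg _ _
  refine solSeminorms_inl_le 0 (I ++ [i]) K u (by positivity) fun t ht => ?_
  have e0 := norm_mixedDeriv_le 0 I K u ht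
  have e2 := norm_mixedDeriv_le 0 (I ++ [i] ++ [i]) K u ht
  rw [mixedDeriv_zero_apply] at e0 e2 ⊢
  refine (norm_weakDeriv_append_le hq (u.2.1 _ (Real.toNNReal_pos.2 t.2)) I i hh).trans ?_
  exact add_le_add (by gcongr) (by gcongr)

/-- Landau's inequality is used on the forward interval `[t, t + h]`, which stays in `(0,∞)` however
close `t` is to `0`; `h ≤ 1` keeps it inside the enlarged compact set. -/
theorem solSeminorms_time_interpolation (j : ℕ) (I : List (Fin n))
    (K : TopologicalSpace.Compacts (Ioi (0 : ℝ))) (u : solSpace 𝕜 n q) {h : ℝ} (hh : 0 < h)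
    (h1 : h ≤ 1) :
    solSeminorms 𝕜 n q (Sum.inl (j + 1, I, K)) u ≤
      2 * solSeminorms 𝕜 n q (Sum.inl (j, I, unitEnlargement K)) u / h
        + h * solSeminorms 𝕜 n q (Sum.inl (j + 1 + 1, I, unitEnlargement K)) u := by
  have h0 : 0 ≤ solSeminorms 𝕜 n q (Sum.inl (j, I, unitEnlargement K)) u := apply_nonneg _ _
  have h2 : 0 ≤ solSeminorms 𝕜 n q (Sum.inl (j + 1 + 1, I, unitEnlargement K)) u :=
    apply_nonneg _ _
  refine solSeminorms_inl_le (j + 1) I K u (by positivity) fun t ht => ?_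
  have hpos : ∀ s ∈ Icc (t : ℝ) (t + h), 0 < s := fun s hs => t.2.trans_le hs.1
  have hmem : ∀ s (hs : s ∈ Icc (t : ℝ) (t + h)), (⟨s, hpos s hs⟩ : Ioi (0 : ℝ)) ∈
      unitEnlargement K := fun s hs => mem_unitEnlargement ht hs.1 (hs.2.trans (by linarith))
  have e : ∀ (k : ℕ) (s : ℝ) (_ : s ∈ Icc (t : ℝ) (t + h)),
      ‖iteratedDerivWithin k (spaceDeriv I u.1) (Ioi 0) s‖ ≤
        solSeminorms 𝕜 n q (Sum.inl (k, I, unitEnlargement K)) u := by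
    intro k s hs
    have := norm_mixedDeriv_le k I (unitEnlargement K) u (hmem s hs)
    rwa [mixedDeriv_apply] at this
  rw [mixedDeriv_apply]
  exact norm_deriv_le_landau hh
    (fun s hs => hasDerivAt_iteratedDerivWithin_Ioi (u.2.2 I) j (hpos s hs))
    (fun s hs => hasDerivAt_iteratedDerivWithin_Ioi (u.2.2 I) (j + 1) (hpos s hs))
    (e j)
    (e (j + 1 + 1))

end Estimates

/-! ### Negligibility -/

section Negligible

variable {Υ : Type*} [Preorder Υ] [IsDirectedOrder Υ] [Nonempty Υ]

/-- Negligibility of the zeroth order quantity and moderateness of the second order one imply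
negligibility of the first order one. -/
theorem AsymptoticScale.isLittleO_of_interpolation (ς : AsymptoticScale Υ) {P₀ P₁ P₂ : Eps → ℝ}
    (hP₁ : ∀ ε, 0 ≤ P₁ ε) (h₀ : ∀ l, P₀ =o[toZero] ς.toFun l)
    (h₂ : ∃ l, (fun ε => ς.toFun l ε * P₂ ε) =o[toZero] fun _ => (1 : ℝ))
    (h : ∀ ε, ∀ s : ℝ, 0 < s → s ≤ 1 → P₁ ε ≤ 2 * P₀ ε / s + s * P₂ ε) (l : Υ) :
    P₁ =o[toZero] ς.toFun l := by
  obtain ⟨k, hk⟩ := h₂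
  -- The step size will be `s = ς_m(ε)`. The choice of `m` makes `s P₂` small compared with `ς_l`;
  -- the choice of `r` does the same for `P₀ / s`, as `P₀ = o(ς_r)` and `ς_r = o(ς_m ς_l)`.
  obtain ⟨m, hm⟩ := ς.exists_isLittleO_mul l k
  obtain ⟨r, hr⟩ := ς.exists_isLittleO_mul m l
  have hm1 : ∀ᶠ ε in toZero, ς.toFun m ε ≤ 1 := by
    have h1 : ς.toFun m =o[toZero] fun _ => (1 : ℝ) := by
      simpa using hm.trans_isBigO ((ς.isBigO_one l).mul (ς.isBigO_one k))
    filter_upwards [h1.bound one_pos] with ε hε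
    simpa using (le_abs_self _).trans hε
  have e1 : (fun ε => 2 * P₀ ε / ς.toFun m ε) =o[toZero] ς.toFun l := by
    have := (((h₀ r).trans hr).const_mul_left 2).mul_isBigO
      (isBigO_refl (fun ε => (ς.toFun m ε)⁻¹) toZero)
    refine this.congr (fun ε => (div_eq_mul_inv _ _).symm) fun ε => ?_
    have := (ς.pos m ε).ne'
    field_simp
  have e2 : (fun ε => ς.toFun m ε * P₂ ε) =o[toZero] ς.toFun l := by
    have h1 := hm.isBigO.mul (isBigO_refl P₂ toZero)
    have h2 := (isBigO_refl (ς.toFun l) toZero).mul_isLittleO hk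
    simp only [mul_one] at h2
    refine IsBigO.trans_isLittleO (h1.congr_right fun ε => ?_) h2
    ring
  refine IsBigO.trans_isLittleO (IsBigO.of_bound 1 ?_) (e1.add e2)
  filter_upwards [hm1] with ε hε
  rw [one_mul, Real.norm_of_nonneg (hP₁ ε)]
  exact (h ε _ (ς.pos m ε) hε).trans (le_abs_self _)

variable {𝕜 : Type*} [RCLike 𝕜] {n : ℕ} {q : ℝ≥0∞} [Fact (1 ≤ q)]

/-- A moderate net in `C^∞(ℝ₊, W^{q,∞}) ∩ C([0,∞), L^q)` is negligible as soon as it is negligible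
for the seminorms of `C([0,∞), L^q)`. -/
theorem mem_negligible_of_inr (hq : q ≠ ⊤) {ς : AsymptoticScale Υ} {U : Eps → solSpace 𝕜 n q}
    (hU : U ∈ moderate ς (solSeminorms 𝕜 n q))
    (h : ∀ b l, (fun ε => solSeminorms 𝕜 n q (Sum.inr b) (U ε)) =o[toZero] ς.toFun l) :
    U ∈ negligible ς (solSeminorms 𝕜 n q) := by
  have hspace : ∀ (I : List (Fin n)) (K : TopologicalSpace.Compacts (Ioi (0 : ℝ))) (l : Υ),
      (fun ε => solSeminorms 𝕜 n q (Sum.inl (0, I, K)) (U ε)) =o[toZero] ς.toFun l := by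
    intro I
    -- New directions are appended on the right, as in `weakDeriv_weakDeriv`. The seminorm of order
    -- two higher is only needed to be moderate, which `hU` supplies, so the induction closes.
    induction I using List.reverseRecOn with
    | nil =>
      intro K l
      obtain ⟨b, hb⟩ := exists_solSeminorms_le_inr (𝕜 := 𝕜) (n := n) (q := q) K
      refine IsBigO.trans_isLittleO (IsBigO.of_bound 1 (Eventually.of_forall fun ε => ?_)) (h b l)
      rw [one_mul, Real.norm_of_nonneg (apply_nonneg _ _), Real.norm_of_nonneg (apply_nonneg _ _)]
      exact hb _
    | append_singleton I i ih =>
      intro K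
      exact ς.isLittleO_of_interpolation (fun ε => apply_nonneg _ _) (ih K)
        (hU (Sum.inl (0, I ++ [i] ++ [i], K)))
        fun ε s hs _ => solSeminorms_space_interpolation hq I i K (U ε) hs
  have htime : ∀ (j : ℕ) (I : List (Fin n)) (K : TopologicalSpace.Compacts (Ioi (0 : ℝ))) (l : Υ),
      (fun ε => solSeminorms 𝕜 n q (Sum.inl (j, I, K)) (U ε)) =o[toZero] ς.toFun l := by
    intro j
    induction j with
    | zero => exact hspace
    -- The induction hypothesis is used on the larger compact set, so it must hold for all `K` at
    -- once.
    | succ j ih =>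
      intro I K
      exact ς.isLittleO_of_interpolation (fun ε => apply_nonneg _ _) (ih I (unitEnlargement K))
        (hU (Sum.inl (j + 1 + 1, I, unitEnlargement K)))
        fun ε s hs hs1 => solSeminorms_time_interpolation j I K (U ε) hs hs1
  rintro (⟨j, I, K⟩ | b) l
  · exact htime j I K l
  · exact h b l

theorem Colombeau.mk_eq_zero_iff {E ι : Type*} [AddCommGroup E] [Module 𝕜 E]
    {ς : AsymptoticScale Υ} {p : SeminormFamily 𝕜 E ι} (h : moderate ς p) :
    Colombeau.mk h = 0 ↔ h.1 ∈ negligible ς p :=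
  Submodule.Quotient.mk_eq_zero _

end Negligible

end VeryWeakHeat

end

open VeryWeakHeat in
theorem mainTheorem3 {Υ : Type*} [Preorder Υ] [IsDirectedOrder Υ] [Nonempty Υ]
    (ς : AsymptoticScale Υ) {𝕜 : Type*} [RCLike 𝕜] (n : ℕ) (q : ℝ≥0∞) [Fact (1 ≤ q)]
    (hq : 1 < q) (hq' : q < ⊤)
    (a : Colombeau ς (coefSeminorms n))
    (ha : a ∈ Colombeau.ofSubset ς (coefSeminorms n) (diffusivities n))
    (u : Colombeau ς (solSeminorms 𝕜 n q))
    (hu : VeryWeakHeatEquation a u 0) (hu₀ : restrictZero ς u = 0) :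
    u = 0 := by
  obtain ⟨A, U, G, hA, -, rfl, hG, hheat⟩ := hu
  have hG' := (Colombeau.mk_eq_zero_iff G).1 hG
  -- The restriction of the class of `U` is by construction the class of the initial values, so its
  -- vanishing is their negligibility.
  have hU₀ : (fun ε => evalZero 𝕜 n q (U.1 ε)) ∈ negligible ς (LqSeminorms 𝕜 n q) :=
    (Colombeau.mk_eq_zero_iff (p := LqSeminorms 𝕜 n q) ⟨_, _⟩).1 hu₀
  refine (Colombeau.mk_eq_zero_iff U).2 (mem_negligible_of_inr hq'.ne U.2 fun b l => ?_)
  -- The energy-type bound has the factor `b`, fixed as `ε → 0`, so both terms on its right-hand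
  -- side remain negligible.
  refine IsBigO.trans_isLittleO (IsBigO.of_bound 1 (Eventually.of_forall fun ε => ?_))
    ((hU₀ () l).add ((hG' (Sum.inr b) l).const_mul_left (b : ℝ)))
  rw [one_mul, Real.norm_of_nonneg (apply_nonneg _ _)]
  exact (solSeminorms_inr_le hq'.ne (hA ε) (hheat ε) b).trans (le_abs_self _)
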